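/- Let $d>0$ and $\mathcal D_d=\{z\in\mathbb C : |\operatorname{Im} z|<d\}$. Call $\omega$ a weight function if it is analytic and zero-free on $\mathcal D_d$, takes values in $(0,1]$ on $\mathbb R$, is even on $\mathbb R$ and non-increasing on $[0,\infty)$, and satisfies $\lim_{x\to\pm\infty}\int_{-d}^{d}|\omega(x+\mathrm iy)|\,\mathrm dy=0$ and $\lim_{y\nearrow d}\int_{-\infty}^{\infty}\bigl(|\omega(x+\mathrm iy)|+|\omega(x-\mathrm iy)|\bigr)\,\mathrm dx<\infty$. It is of SE type if $\alpha_1 e^{-(\beta|x|)^\rho}\le\omega(x)\le\alpha_2e^{-(\beta|x|)^\rho}$ for all $x\in\mathbb R$, with some $\alpha_1,\alpha_2,\beta>0$, $\rho\ge1$, and of DE type if $\alpha_1 e^{-\beta_1\exp(\gamma|x|)}\le\omega(x)\le\alpha_2 e^{-\beta_2\exp(\gamma|x|)}$ for all $x\in\mathbb R$, with some $\alpha_1,\alpha_2,\gamma>0$ and $\beta_1\ge\beta_2>0$. Let $H^\infty(\mathcal D_d,\omega)$ be the space of analytic $f$ on $\mathcal D_d$ with $\|f\|=\sup_{z\in\mathcal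 D_d}|f(z)/\omega(z)|<\infty$. Let $A_n(f)=\sum_{i=1}^n w_i e^{\xi_i^2}f(\xi_i)$ be the $n$-point Gauss–Hermite quadrature for $I(f)=\int_{-\infty}^\infty f(x)\,\mathrm dx$, where $\xi_1<\dots<\xi_n$ are the zeros of the physicist's Hermite polynomial of degree $n$ and the weights $w_i$ are determined by $\sum_i w_i p(\xi_i)=\int_{-\infty}^\infty p(x)e^{-x^2}\,\mathrm dx$ for all real polynomials $p$ of degree at most $2n-1$. Let $e_n(\omega)=\sup\{|A_n(f)-I(f)| : f\in H^\infty(\mathcal D_d,\omega),\ \|f\|\le1\}$ be its worst-case error. For every weight function $\omega$ of SE or DE type there is a constant $c>0$, independent of $n$, such that for all $n\ge2$ $$e_n(\omega)\ \ge\ c\,\frac{\exp\bigl(-2d\sqrt{2n+1}\bigr)}{(n+1/2)^2};$$ moreover $c$ can be chosen to depend only on $d,\alpha_1,\beta,\rho$ in the SE case and only on $d,\alpha_1,\beta_1,\gamma$ in the DE case. In particular, for every constant $C>2\sqrt2\,d$, the worst-case error does not decay as fast as $\exp(-C\sqrt n)$: $\exp(-C\sqrt n)=o(e_n(\omega))$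 as $n\to\infty$. -/

import Mathlib

open Polynomial MeasureTheory Filter Topology

namespace GaussHermite

noncomputable section

/-! ## Physicist's Hermite polynomials -/

/-- The physicist's Hermite polynomials `H n`, i.e. `H 0 = 1` and `H (n+1) = 2 X H n - (H n)'`. -/
def physHermite : ℕ → ℝ[X]
  | 0 => 1
  | n + 1 => 2 * X * physHermite n - derivative (physHermite n)

theorem derivative_physHermite (n : ℕ) :
    derivative (physHermite (n + 1)) = C (2 * ((n : ℝ) + 1)) * physHermite n := by
  induction n with
  | zero => simp [physHermite, C_ofNat]
  | succ n ih =>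
    have h1 : physHermite (n + 2) =
      2 * X * physHermite (n + 1) - derivative (physHermite (n + 1)) := rfl
    have h2 : physHermite (n + 1) =
      2 * X * physHermite n - derivative (physHermite n) := rfl
    rw [h1, ih]
    simp only [derivative_sub, derivative_mul, derivative_ofNat, derivative_X, ih, derivative_C]
    have h3 : derivative (physHermite n) = 2 * X * physHermite n - physHermite (n + 1) := by
      rw [h2]; ring
    rw [h3]
    simp only [C_mul, C_add, C_ofNat, map_natCast, Nat.cast_add, Nat.cast_one, C_1]
    ring

theorem degree_physHermite (n : ℕ) : (physHermite n).degree = n := by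
  induction n with
  | zero => simp [physHermite]
  | succ n ih =>
    have h0 : physHermite n ≠ 0 := by
      intro h; rw [h] at ih; simp at ih
    have h1 : (2 * X * physHermite n).degree = ((n + 1 : ℕ) : WithBot ℕ) := by
      have h2 : (2 : ℝ[X]) = C 2 := by simp [C_ofNat]
      rw [h2, degree_mul, degree_mul, degree_C (by norm_num), degree_X, ih]
      push_cast; rw [zero_add, add_comm]
    have h2 : physHermite (n + 1) = 2 * X * physHermite n - derivative (physHermite n) := rfl
    rw [h2, degree_sub_eq_left_of_degree_lt, h1]
    rw [h1]
    refine lt_trans (degree_derivative_lt h0) ?_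
    rw [ih]
    exact_mod_cast Nat.lt_succ_self n

theorem physHermite_ne_zero (n : ℕ) : physHermite n ≠ 0 := by
  intro h
  have := degree_physHermite n
  rw [h] at this
  simp at this

theorem natDegree_physHermite (n : ℕ) : (physHermite n).natDegree = n :=
  natDegree_eq_of_degree_eq_some (degree_physHermite n)

theorem physHermite_no_common_root (n : ℕ) (a : ℝ) :
    ¬ ((physHermite (n + 1)).eval a = 0 ∧ (physHermite n).eval a = 0) := by
  induction n with
  | zero => simp [physHermite]
  | succ n ih =>
    rintro ⟨h1, h2⟩
    refine ih ⟨h2, ?_⟩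
    have h3 : physHermite (n + 2) =
      2 * X * physHermite (n + 1) - derivative (physHermite (n + 1)) := rfl
    rw [h3, derivative_physHermite] at h1
    simp only [eval_sub, eval_mul, h2, eval_C, mul_zero, zero_sub, neg_eq_zero] at h1
    rcases mul_eq_zero.1 h1 with h | h
    · have : (0 : ℝ) < 2 * ((n : ℝ) + 1) := by positivity
      exact absurd h this.ne'
    · exact h

theorem nodup_roots_physHermite (n : ℕ) : (physHermite n).roots.Nodup := by
  rw [Multiset.nodup_iff_count_le_one]
  intro a
  rw [count_roots]
  by_contra! h
  obtain ⟨h1, h2⟩ := (one_lt_rootMultiplicity_iff_isRoot (physHermite_ne_zero n)).1 h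
  cases n with
  | zero => simp [physHermite] at h1
  | succ n =>
    refine physHermite_no_common_root n a ⟨h1, ?_⟩
    rw [derivative_physHermite, IsRoot, eval_mul, eval_C] at h2
    rcases mul_eq_zero.1 h2 with h | h
    · have : (0 : ℝ) < 2 * ((n : ℝ) + 1) := by positivity
      exact absurd h this.ne'
    · exact h

theorem integrable_polynomial_mul_exp (p : ℝ[X]) :
    Integrable (fun x : ℝ => p.eval x * Real.exp (-x ^ 2)) := by
  induction p using Polynomial.induction_on' with
  | add p q hp hq =>
    refine (hp.add hq).congr (Eventually.of_forall fun x => ?_)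
    simp [add_mul]
  | monomial k a =>
    have h := (integrable_rpow_mul_exp_neg_mul_sq (b := 1) one_pos (s := (k : ℝ))
      (by have : (0 : ℝ) ≤ k := k.cast_nonneg
          linarith)).const_mul a
    refine h.congr (Eventually.of_forall fun x => ?_)
    simp [eval_monomial, mul_assoc]

theorem integral_mul_physHermite_eq_zero (n : ℕ) (p : ℝ[X]) (hp : p.degree < n) :
    ∫ x : ℝ, (p * physHermite n).eval x * Real.exp (-x ^ 2) = 0 := by
  induction n generalizing p with
  | zero =>
    have : p = 0 := by
      rw [← degree_eq_bot]
      exact Nat.WithBot.lt_zero_iff.1 (by simpa using hp)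
    simp [this]
  | succ n ih =>
    have hd : ∀ x : ℝ, HasDerivAt
        (fun x => (p * physHermite n).eval x * Real.exp (-x ^ 2))
        ((derivative p * physHermite n).eval x * Real.exp (-x ^ 2)
          - (p * physHermite (n + 1)).eval x * Real.exp (-x ^ 2)) x := by
      intro x
      have h1 := (p * physHermite n).hasDerivAt x
      have h2 : HasDerivAt (fun x : ℝ => Real.exp (-x ^ 2))
          (Real.exp (-x ^ 2) * (-(2 * x))) x := by
        have := ((hasDerivAt_pow 2 x).neg).exp
        simpa using this
      refine (h1.mul h2).congr_deriv ?_
      have h3 : physHermite (n + 1) = 2 * X * physHermite n - derivative (physHermite n) := rfl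
      rw [h3]
      simp only [derivative_mul, eval_add, eval_mul, eval_sub, eval_X, eval_ofNat]
      ring
    have hi := integrable_polynomial_mul_exp (derivative p * physHermite n)
    have hj := integrable_polynomial_mul_exp (p * physHermite (n + 1))
    have key := integral_eq_zero_of_hasDerivAt_of_integrable hd (hi.sub hj)
      (integrable_polynomial_mul_exp (p * physHermite n))
    rw [integral_sub hi hj] at key
    have h0 := ih (derivative p) (by
      by_cases h : p = 0
      · simp [h]
      · have h4 := degree_derivative_lt h
        refine lt_of_lt_of_le h4 ?_
        rw [degree_eq_natDegree h] at hp ⊢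
        have : p.natDegree < n + 1 := by exact_mod_cast hp
        exact_mod_cast Nat.lt_succ_iff.1 this)
    rw [h0] at key
    linarith

theorem card_roots_physHermite (n : ℕ) : Multiset.card (physHermite n).roots = n := by
  obtain ⟨r, h1, h2, h3⟩ := exists_prod_multiset_X_sub_C_mul (physHermite n)
  rw [natDegree_physHermite] at h2
  by_contra hne
  have hlt : Multiset.card (physHermite n).roots < n := by omega
  set Q : ℝ[X] := ((physHermite n).roots.map fun a => X - C a).prod with hQ
  have hQm : Q.Monic := monic_multiset_prod_of_monic _ _ fun a _ => monic_X_sub_C a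
  have hQd : Q.degree < n := by
    rw [degree_eq_natDegree hQm.ne_zero, hQ, natDegree_multiset_prod_X_sub_C_eq_card]
    exact_mod_cast hlt
  have hr0 : r ≠ 0 := by
    rintro rfl
    exact physHermite_ne_zero n (by rw [← h1, mul_zero])
  have hr : ∀ x : ℝ, r.eval x ≠ 0 := by
    intro x hx
    have : x ∈ r.roots := (mem_roots hr0).2 hx
    simp [h3] at this
  have hsign : (∀ x : ℝ, 0 < r.eval x) ∨ (∀ x : ℝ, r.eval x < 0) := by
    by_contra! hcon
    obtain ⟨⟨x, hx⟩, ⟨y, hy⟩⟩ := hcon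
    obtain ⟨z, hz⟩ := mem_range_of_exists_le_of_exists_ge r.continuous ⟨x, hx⟩ ⟨y, hy⟩
    exact hr z hz
  have horth := integral_mul_physHermite_eq_zero n Q hQd
  have hint := integrable_polynomial_mul_exp (Q * physHermite n)
  have hev : ∀ x : ℝ, (Q * physHermite n).eval x = Q.eval x ^ 2 * r.eval x := by
    intro x
    rw [← h1]; simp only [eval_mul]; ring
  obtain ⟨x0, hx0⟩ : ∃ x0 : ℝ, Q.eval x0 ≠ 0 := by
    by_contra! h
    exact hQm.ne_zero (Polynomial.funext fun x => by simpa using h x)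
  have hcont : Continuous fun x : ℝ => (Q * physHermite n).eval x * Real.exp (-x ^ 2) := by
    fun_prop
  rcases hsign with hs | hs
  · have := integral_pos_of_integrable_nonneg_nonzero (x := x0) hcont hint
      (fun x => by
        simp only [Pi.zero_apply]
        rw [hev]
        have := hs x
        positivity)
      (by
        rw [hev]
        have := hs x0
        positivity)
    linarith
  · have := integral_pos_of_integrable_nonneg_nonzero (x := x0) hcont.neg hint.neg
      (fun x => by
        simp only [Pi.zero_apply, Pi.neg_apply]
        rw [hev]
        have h5 : 0 < - r.eval x := neg_pos.2 (hs x)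
        have : 0 ≤ Q.eval x ^ 2 * (-r.eval x) * Real.exp (-x ^ 2) := by positivity
        linarith)
      (by
        simp only [Pi.neg_apply, neg_ne_zero]
        rw [hev]
        have := (hs x0).ne
        positivity)
    simp only [Pi.neg_apply, integral_neg] at this
    linarith

/-! ## Gauss-Hermite nodes and weights -/

/-- The set of real zeros of the `n`-th physicist's Hermite polynomial. -/
def hermiteZeros (n : ℕ) : Finset ℝ := (physHermite n).roots.toFinset

theorem card_hermiteZeros (n : ℕ) : (hermiteZeros n).card = n := by
  rw [hermiteZeros, Multiset.toFinset_card_of_nodup (nodup_roots_physHermite n),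
    card_roots_physHermite]

/-- The Hermite nodes `ξ 0 < ξ 1 < ⋯ < ξ (n-1)`: the zeros of the `n`-th physicist's Hermite
polynomial in increasing order. -/
def hermiteNode (n : ℕ) : Fin n → ℝ :=
  (hermiteZeros n).orderEmbOfFin (card_hermiteZeros n)

theorem hermiteNode_injective (n : ℕ) : Function.Injective (hermiteNode n) :=
  ((hermiteZeros n).orderEmbOfFin (card_hermiteZeros n)).injective

theorem eval_hermiteNode (n : ℕ) (i : Fin n) : (physHermite n).eval (hermiteNode n i) = 0 := by
  have h : hermiteNode n i ∈ (physHermite n).roots.toFinset :=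
    (hermiteZeros n).orderEmbOfFin_mem (card_hermiteZeros n) i
  rw [Multiset.mem_toFinset, mem_roots (physHermite_ne_zero n)] at h
  exact h

/-- There is exactly one choice of weights at the Hermite nodes that integrates all
polynomials of degree at most `2n - 1` exactly with respect to `exp (-x^2) dx`. -/
theorem existsUnique_hermiteWeight (n : ℕ) :
    ∃! w : Fin n → ℝ, ∀ p : ℝ[X], p.degree < ((2 * n : ℕ) : WithBot ℕ) →
      ∑ i, w i * p.eval (hermiteNode n i) = ∫ x : ℝ, p.eval x * Real.exp (-x ^ 2) := by
  have hinj : Set.InjOn (hermiteNode n) (Finset.univ : Finset (Fin n)) :=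
    (hermiteNode_injective n).injOn
  refine ⟨fun i => ∫ x : ℝ, (Lagrange.basis Finset.univ (hermiteNode n) i).eval x *
    Real.exp (-x ^ 2), ?_, ?_⟩
  · intro p hp
    set H := physHermite n with hH
    have hdm : p % H + H * (p / H) = p := EuclideanDomain.mod_add_div p H
    have hmod : (p % H).degree < n := by
      have := degree_mod_lt p (physHermite_ne_zero n)
      rwa [degree_physHermite] at this
    have hdiv : (p / H).degree < n := by
      by_cases hlt : p.degree < H.degree
      · rw [(Polynomial.div_eq_zero_iff (physHermite_ne_zero n)).2 hlt, degree_zero]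
        exact WithBot.bot_lt_coe n
      · have h1 := degree_add_div (physHermite_ne_zero n) (not_lt.1 hlt)
        rw [← h1, degree_physHermite, two_mul, Nat.cast_add] at hp
        exact lt_of_add_lt_add_left hp
    have hev : ∀ i, p.eval (hermiteNode n i) = (p % H).eval (hermiteNode n i) := by
      intro i
      conv_lhs => rw [← hdm]
      rw [eval_add, eval_mul, hH, eval_hermiteNode, zero_mul, add_zero]
    have hint : ∫ x : ℝ, p.eval x * Real.exp (-x ^ 2)
        = ∫ x : ℝ, (p % H).eval x * Real.exp (-x ^ 2) := by
      have h1 := integral_mul_physHermite_eq_zero n (p / H) hdiv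
      have h2 := integral_add (integrable_polynomial_mul_exp (p % H))
        (integrable_polynomial_mul_exp (p / H * physHermite n))
      rw [h1, add_zero] at h2
      rw [← h2]
      refine integral_congr_ae (Eventually.of_forall fun x => ?_)
      conv_lhs => rw [← hdm]
      simp only [eval_add, eval_mul, hH]
      ring
    have hlag := Lagrange.eq_interpolate (f := p % H) hinj (by simpa using hmod)
    rw [hint]
    simp only [hev]
    conv_rhs => rw [hlag]
    simp only [Lagrange.interpolate_apply, eval_finsetSum, eval_mul, eval_C, Finset.sum_mul]
    rw [integral_finsetSum]
    · refine Finset.sum_congr rfl fun i _ => ?_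
      rw [mul_comm, ← integral_const_mul]
      simp only [mul_assoc]
    · intro i _
      simpa only [mul_assoc] using (integrable_polynomial_mul_exp
        (Lagrange.basis Finset.univ (hermiteNode n) i)).const_mul _
  · intro w hw
    funext i
    have hn : 0 < n := i.pos
    rw [← hw (Lagrange.basis Finset.univ (hermiteNode n) i) ?_]
    · rw [Finset.sum_eq_single i]
      · rw [Lagrange.eval_basis_self hinj (Finset.mem_univ i), mul_one]
      · intro j _ hj
        rw [Lagrange.eval_basis_of_ne hj.symm (Finset.mem_univ j), mul_zero]
      · intro h; exact absurd (Finset.mem_univ i) h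
    · rw [Lagrange.degree_basis hinj (Finset.mem_univ i)]
      simp only [Finset.card_univ, Fintype.card_fin]
      exact_mod_cast (by omega : n - 1 < 2 * n)

/-- The Gauss-Hermite weights: the unique weights for which the rule with the Hermite nodes
is exact for polynomials of degree at most `2n - 1` with respect to `exp (-x^2) dx`. -/
def hermiteWeight (n : ℕ) : Fin n → ℝ := (existsUnique_hermiteWeight n).choose

/-- A quadrature rule on the real line with nodes `ξ i` and weights `w i`, applied to (the
restriction to `ℝ` of) a complex function. -/
def quadrature {n : ℕ} (ξ w : Fin n → ℝ) (f : ℂ → ℂ) : ℂ := ∑ i, (w i : ℂ) * f (ξ i)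

/-- The Gauss-Hermite quadrature for the unweighted integral over `ℝ`. -/
def gaussHermite (n : ℕ) : (ℂ → ℂ) → ℂ :=
  quadrature (hermiteNode n) fun i => Real.exp (hermiteNode n i ^ 2) * hermiteWeight n i

/-! ## Weight functions and weighted Hardy spaces -/

/-- The open strip of half-width `d` around the real line. -/
def strip (d : ℝ) : Set ℂ := {z | |z.im| < d}

/-- The class `B` of analytic functions on the strip. Functions on the strip are represented by
functions on `ℂ`, whose values outside the strip play no role. -/
structure IsClassB (d : ℝ) (ω : ℂ → ℂ) : Prop where
  analytic : AnalyticOnNhd ℂ ω (strip d)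
  tendsto_atTop : Tendsto
    (fun x : ℝ => ∫⁻ y in Set.Ioo (-d) d, ‖ω (x + y * Complex.I)‖ₑ) atTop (𝓝 0)
  tendsto_atBot : Tendsto
    (fun x : ℝ => ∫⁻ y in Set.Ioo (-d) d, ‖ω (x + y * Complex.I)‖ₑ) atBot (𝓝 0)
  tendsto_boundary : ∃ L : NNReal, Tendsto
    (fun y : ℝ => ∫⁻ x : ℝ, (‖ω (x + y * Complex.I)‖ₑ + ‖ω (x - y * Complex.I)‖ₑ))
    (𝓝[<] d) (𝓝 (L : ENNReal))

/-- Weight functions on the strip: members of the class `B` without zeros in the strip, with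
values in `(0,1]` on the real line, even on the real line and decreasing away from `0`. -/
structure IsWeight (d : ℝ) (ω : ℂ → ℂ) : Prop extends IsClassB d ω where
  ne_zero : ∀ z ∈ strip d, ω z ≠ 0
  real : ∀ x : ℝ, (ω x).im = 0
  pos : ∀ x : ℝ, 0 < (ω x).re
  le_one : ∀ x : ℝ, (ω x).re ≤ 1
  even : ∀ x : ℝ, ω ((-x : ℝ) : ℂ) = ω x
  antitone : AntitoneOn (fun x : ℝ => (ω x).re) (Set.Ici 0)

/-- Single-exponential decay with parameters `α₁, α₂, β > 0` and `ρ ≥ 1`. -/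
structure IsSE (α₁ α₂ β ρ : ℝ) (ω : ℂ → ℂ) : Prop where
  α₁_pos : 0 < α₁
  α₂_pos : 0 < α₂
  β_pos : 0 < β
  one_le_ρ : 1 ≤ ρ
  lower : ∀ x : ℝ, α₁ * Real.exp (-(β * |x|) ^ ρ) ≤ (ω x).re
  upper : ∀ x : ℝ, (ω x).re ≤ α₂ * Real.exp (-(β * |x|) ^ ρ)

/-- Double-exponential decay with parameters `α₁, α₂, β₁, β₂, γ > 0`, `β₁ ≥ β₂`. -/
structure IsDE (α₁ α₂ β₁ β₂ γ : ℝ) (ω : ℂ → ℂ) : Prop where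
  α₁_pos : 0 < α₁
  α₂_pos : 0 < α₂
  β₁_pos : 0 < β₁
  β₂_pos : 0 < β₂
  γ_pos : 0 < γ
  β₂_le_β₁ : β₂ ≤ β₁
  lower : ∀ x : ℝ, α₁ * Real.exp (-β₁ * Real.exp (γ * |x|)) ≤ (ω x).re
  upper : ∀ x : ℝ, (ω x).re ≤ α₂ * Real.exp (-β₂ * Real.exp (γ * |x|))

/-- The weighted Hardy space: analytic functions on the strip with `f / ω` bounded there. -/
def hardySpace (d : ℝ) (ω : ℂ → ℂ) : Set (ℂ → ℂ) :=
  {f | AnalyticOnNhd ℂ f (strip d) ∧ BddAbove ((fun z => ‖f z / ω z‖) '' strip d)}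

/-- The norm of the weighted Hardy space. -/
def hardyNorm (d : ℝ) (ω f : ℂ → ℂ) : ℝ := sSup ((fun z => ‖f z / ω z‖) '' strip d)

/-- The worst-case error of an integration rule `A` over the unit ball of the weighted
Hardy space. -/
def worstCaseError (d : ℝ) (ω : ℂ → ℂ) (A : (ℂ → ℂ) → ℂ) : ℝ :=
  sSup ((fun f => ‖A f - ∫ x : ℝ, f x‖) '' {f | f ∈ hardySpace d ω ∧ hardyNorm d ω f ≤ 1})

end

end GaussHermite

namespace GaussHermite

/-! ## Separation of the Hermite nodes -/

/-! The proof tests the rule against one fooling function: `ω` times the squared Blaschke product B²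
of the strip with zeros at the Hermite nodes. Since |B| ≤ 1 on the strip, this function lies in the
unit ball. The rule annihilates it, and squaring makes it nonnegative on the real line, so the error
is its integral, which is at least ω(2) ∫₀² B².

It remains to see that B² is not too small. On the real line each factor of B has modulus tanh(π|x -
ξ|/(4d)), so a bound on B² is a bound on a sum of -log tanh over the nodes. Sturm comparison
(`physHermite_zero_gap`) keeps nodes at least h = π/√(2n+1) apart, so on each side of x the sum is
dominated by one over an arithmetic progression. By `sum_logCoth_le` each side costs at most
d√(2n+1)/2 plus the term of the nearest node. Two sides and the square give exp(-2d√(2n+1)).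

At distance h/4 from all nodes, the nearest-node terms cost a factor of order h⁴, hence the
(n+1/2)⁻². Of x and x + h/2, at least one is that far from every node, so integrating the pointwise
bound over [0,1] covers enough of [0,2]. -/

theorem physHermite_ode (n : ℕ) (x : ℝ) :
    (derivative (derivative (physHermite n))).eval x - 2 * x * (derivative (physHermite n)).eval x
      + 2 * n * (physHermite n).eval x = 0 := by
  cases n with
  | zero => simp [physHermite]
  | succ n =>
    have h : physHermite (n + 1) = 2 * X * physHermite n - derivative (physHermite n) := rfl
    rw [derivative_physHermite, derivative_C_mul, h]
    simp only [eval_sub, eval_mul, eval_C, eval_X, eval_ofNat]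
    push_cast
    ring

theorem eval_derivative_physHermite_ne_zero {n : ℕ} {a : ℝ} (ha : (physHermite n).eval a = 0) :
    (derivative (physHermite n)).eval a ≠ 0 := by
  cases n with
  | zero => simp [physHermite] at ha
  | succ n =>
    rw [derivative_physHermite, eval_mul, eval_C]
    have : (0 : ℝ) < 2 * ((n : ℝ) + 1) := by positivity
    exact mul_ne_zero this.ne' fun h => physHermite_no_common_root n a ⟨ha, h⟩

/-- A differentiable function that is positive to the left of one of its zeros has nonpositive
derivative there. -/
theorem hasDerivAt_nonpos_of_pos_left {f : ℝ → ℝ} {f' a b : ℝ} (hab : a < b)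
    (hf : HasDerivAt f f' b) (hb : f b = 0) (hpos : ∀ x ∈ Set.Ioo a b, 0 < f x) : f' ≤ 0 := by
  have h := (hasDerivAt_iff_tendsto_slope.1 hf).mono_left
    (nhdsWithin_mono b (show Set.Iio b ⊆ {b}ᶜ from fun x hx => ne_of_lt hx))
  refine le_of_tendsto h ?_
  filter_upwards [Ioo_mem_nhdsLT hab] with x hx
  rw [slope_def_field, hb, sub_zero]
  exact div_nonpos_of_nonneg_of_nonpos (hpos x hx).le (by linarith [hx.2])

/-- The value at one interior point serves as the multiplier `s`, which spares a case distinction on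
the sign of `f`. -/
theorem exists_sign_of_ne_zero {f : ℝ → ℝ} (hf : Continuous f) {a b : ℝ}
    (h0 : ∀ x ∈ Set.Ioo a b, f x ≠ 0) : ∃ s : ℝ, s ≠ 0 ∧ ∀ x ∈ Set.Ioo a b, 0 < s * f x := by
  rcases (Set.Ioo a b).eq_empty_or_nonempty with he | ⟨c, hc⟩
  · exact ⟨1, one_ne_zero, by simp [he]⟩
  refine ⟨f c, h0 c hc, fun x hx => ?_⟩
  by_contra! hle
  have h := isPreconnected_Ioo.intermediate_value hx hc
    (f := fun y => f c * f y) (by fun_prop)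
  obtain ⟨z, hz, hz0⟩ := h ⟨hle, (mul_self_nonneg (f c))⟩
  rcases mul_eq_zero.1 hz0 with h1 | h1
  · exact h0 c hc h1
  · exact h0 z hz h1

/-- Sturm comparison: consecutive zeros of `H n` are at least `π / √(2n+1)` apart. -/
theorem physHermite_zero_gap {n : ℕ} {a b : ℝ} (hab : a < b) (ha : (physHermite n).eval a = 0)
    (hb : (physHermite n).eval b = 0) (h0 : ∀ x ∈ Set.Ioo a b, (physHermite n).eval x ≠ 0) :
    Real.pi / √(2 * n + 1) ≤ b - a := by
  set P := physHermite n with hP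
  have hl2 : √(2 * n + 1 : ℝ) ^ 2 = 2 * n + 1 := Real.sq_sqrt (by positivity)
  have hl : 0 < √(2 * n + 1 : ℝ) := by positivity
  set l := √(2 * n + 1 : ℝ)
  by_contra! hlt
  rw [lt_div_iff₀ hl] at hlt
  obtain ⟨s, hs, hpos⟩ := exists_sign_of_ne_zero P.continuous h0
  have hexp : ∀ x : ℝ, HasDerivAt (fun x : ℝ => Real.exp (-x ^ 2 / 2))
      (Real.exp (-x ^ 2 / 2) * (-x)) x := by
    intro x
    refine (((hasDerivAt_pow 2 x).neg).div_const 2).exp.congr_deriv ?_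
    simp only [Pi.neg_apply]
    push_cast; ring
  -- Wronskian u'v - uv' of u = s e^{-x²/2} P, with u'' = (x² - l²)u, and v = sin(l(x - a)), with
  -- v'' = -l²v. Its derivative is x²uv.
  have hW : ∀ x : ℝ, HasDerivAt
      (fun x : ℝ => s * (Real.exp (-x ^ 2 / 2) *
        (((derivative P).eval x - x * P.eval x) * Real.sin (l * (x - a))
          - P.eval x * (l * Real.cos (l * (x - a))))))
      (s * P.eval x * (x ^ 2 * Real.exp (-x ^ 2 / 2) * Real.sin (l * (x - a)))) x := by
    intro x
    have hlin : HasDerivAt (fun x : ℝ => l * (x - a)) l x := by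
      simpa using ((hasDerivAt_id x).sub_const a).const_mul l
    refine (((hexp x).mul (((((derivative P).hasDerivAt x).sub
      ((hasDerivAt_id x).mul (P.hasDerivAt x))).mul hlin.sin).sub
      ((P.hasDerivAt x).mul (hlin.cos.const_mul l)))).const_mul s).congr_deriv ?_
    have hode := physHermite_ode n x
    rw [← hP] at hode
    simp only [id, Pi.sub_apply, Pi.mul_apply]
    linear_combination s * Real.exp (-x ^ 2 / 2) * Real.sin (l * (x - a)) * hode
      + s * Real.exp (-x ^ 2 / 2) * Real.sin (l * (x - a)) * P.eval x * hl2
  have hsin : ∀ x, a < x → x ≤ b → 0 < Real.sin (l * (x - a)) := fun x h1 h2 =>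
    Real.sin_pos_of_pos_of_lt_pi (mul_pos hl (by linarith)) (by nlinarith)
  have hmono := monotoneOn_of_deriv_nonneg (convex_Icc a b)
    (fun x _ => (hW x).continuousAt.continuousWithinAt)
    (fun x _ => (hW x).differentiableAt.differentiableWithinAt)
    (by
      intro x hx
      rw [interior_Icc] at hx
      rw [(hW x).deriv]
      have h1 := hpos x hx
      have h2 := hsin x hx.1 hx.2.le
      positivity)
  -- The Wronskian increases from 0 at `a`, yet at `b` it equals u'(b)v(b), which is negative
  -- because `b` is a simple zero approached from the positive side.
  have hWab := hmono (Set.left_mem_Icc.2 hab.le) (Set.right_mem_Icc.2 hab.le) hab.le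
  simp only [ha, hb, sub_self, mul_zero, zero_mul, Real.sin_zero, sub_zero] at hWab
  have hle : s * (derivative P).eval b ≤ 0 :=
    hasDerivAt_nonpos_of_pos_left hab ((P.hasDerivAt b).const_mul s) (by simp [hb]) hpos
  have hlt' : s * (derivative P).eval b < 0 :=
    lt_of_le_of_ne hle (mul_ne_zero hs (eval_derivative_physHermite_ne_zero hb))
  have h3 := mul_neg_of_neg_of_pos hlt'
    (mul_pos (Real.exp_pos (-b ^ 2 / 2)) (hsin b hab le_rfl))
  nlinarith

theorem hermiteNode_strictMono (n : ℕ) : StrictMono (hermiteNode n) :=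
  ((hermiteZeros n).orderEmbOfFin (card_hermiteZeros n)).strictMono

theorem exists_hermiteNode_eq {n : ℕ} {x : ℝ} (hx : (physHermite n).eval x = 0) :
    ∃ i, hermiteNode n i = x := by
  have h : x ∈ Set.range (hermiteNode n) := by
    rw [hermiteNode, Finset.range_orderEmbOfFin]
    simpa [hermiteZeros, physHermite_ne_zero n] using hx
  exact h

theorem hermiteNode_gap_of_lt {n : ℕ} {i j : Fin n} (hij : i < j) :
    Real.pi / √(2 * n + 1) ≤ hermiteNode n j - hermiteNode n i := by
  have hk : (i : ℕ) + 1 < n := lt_of_le_of_lt (Nat.succ_le_of_lt hij) j.2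
  -- Sturm comparison is needed only for neighbouring indices; any zero strictly between them would
  -- be a node with an index strictly between.
  set k : Fin n := ⟨i + 1, hk⟩
  have hik : i < k := Fin.lt_def.2 (Nat.lt_succ_self _)
  have hkj : hermiteNode n k ≤ hermiteNode n j :=
    (hermiteNode_strictMono n).monotone (Fin.le_def.2 (Nat.succ_le_of_lt hij))
  refine (physHermite_zero_gap (hermiteNode_strictMono n hik) (eval_hermiteNode n i)
    (eval_hermiteNode n k) ?_).trans (by linarith)
  rintro x ⟨h1, h2⟩ hx
  obtain ⟨m, rfl⟩ := exists_hermiteNode_eq hx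
  have h3 := Fin.lt_def.1 ((hermiteNode_strictMono n).lt_iff_lt.1 h1)
  have h4 := Fin.lt_def.1 ((hermiteNode_strictMono n).lt_iff_lt.1 h2)
  simp only [k] at h4
  omega

theorem hermiteNode_gap {n : ℕ} {i j : Fin n} (hij : i ≠ j) :
    Real.pi / √(2 * n + 1) ≤ |hermiteNode n i - hermiteNode n j| := by
  rcases lt_or_gt_of_ne hij with h | h
  · rw [abs_sub_comm]; exact (hermiteNode_gap_of_lt h).trans (le_abs_self _)
  · exact (hermiteNode_gap_of_lt h).trans (le_abs_self _)

/-! ## Sums of `-log tanh` over separated points -/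

/-- The function `-log tanh` on the positive half-line. -/
noncomputable def logCoth (u : ℝ) : ℝ :=
  Real.log (1 + Real.exp (-2 * u)) - Real.log (1 - Real.exp (-2 * u))

theorem exp_neg_logCoth {u : ℝ} (hu : 0 < u) :
    Real.exp (-logCoth u) = (1 - Real.exp (-2 * u)) / (1 + Real.exp (-2 * u)) := by
  have h1 : 0 < 1 - Real.exp (-2 * u) := by
    have : Real.exp (-2 * u) < 1 := Real.exp_lt_one_iff.2 (by linarith)
    linarith
  rw [logCoth, neg_sub, Real.exp_sub, Real.exp_log h1, Real.exp_log (by positivity)]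

theorem logCoth_antitoneOn : AntitoneOn logCoth (Set.Ioi 0) := by
  intro u hu v _ huv
  have hu : 0 < u := hu
  have h1 : Real.exp (-2 * u) < 1 := Real.exp_lt_one_iff.2 (by linarith)
  have h2 : Real.exp (-2 * v) ≤ Real.exp (-2 * u) := Real.exp_le_exp.2 (by linarith)
  exact sub_le_sub (Real.log_le_log (by positivity) (by linarith))
    (Real.log_le_log (by linarith) (by linarith))

theorem logCoth_nonneg {u : ℝ} (hu : 0 < u) : 0 ≤ logCoth u := by
  have h1 : Real.exp (-2 * u) < 1 := Real.exp_lt_one_iff.2 (by linarith)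
  exact sub_nonneg.2 (Real.log_le_log (by linarith) (by linarith [Real.exp_pos (-2 * u)]))

/-- The even terms make up a quarter of ζ(2) = π²/6; the odd ones are the rest. -/
theorem hasSum_one_div_odd_sq :
    HasSum (fun m : ℕ => 1 / (2 * (m : ℝ) + 1) ^ 2) (Real.pi ^ 2 / 8) := by
  have h := hasSum_zeta_two
  have he : HasSum (fun m : ℕ => 1 / ((2 * m : ℕ) : ℝ) ^ 2) (1 / 4 * (Real.pi ^ 2 / 6)) := by
    refine (h.mul_left (1 / 4)).congr_fun fun m => ?_
    push_cast
    rw [mul_pow, one_div_mul_one_div]; norm_num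
  have ho : Summable (fun m : ℕ => 1 / ((2 * m + 1 : ℕ) : ℝ) ^ 2) :=
    h.summable.comp_injective (i := fun m : ℕ => 2 * m + 1) fun a b hab => by simpa using hab
  have hs := (he.even_add_odd (f := fun m : ℕ => 1 / (m : ℝ) ^ 2) ho.hasSum).unique h
  have := ho.hasSum
  rw [show (∑' m : ℕ, 1 / ((2 * m + 1 : ℕ) : ℝ) ^ 2) = Real.pi ^ 2 / 8 by linarith] at this
  simpa using this

theorem sum_exp_neg_mul_le {t : ℝ} (ht : 0 < t) (N : ℕ) :
    ∑ k ∈ Finset.range N, Real.exp (-(t * ((k : ℝ) + 1))) ≤ 1 / t := by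
  have hq1 : Real.exp (-t) < 1 := Real.exp_lt_one_iff.2 (by linarith)
  have hq0 := Real.exp_pos (-t)
  have hterm : ∀ k : ℕ, Real.exp (-(t * ((k : ℝ) + 1))) = Real.exp (-t) * Real.exp (-t) ^ k := by
    intro k
    rw [← Real.exp_nat_mul, ← Real.exp_add]; ring_nf
  simp only [hterm]
  rw [← Finset.mul_sum]
  have hgeo : ∑ k ∈ Finset.range N, Real.exp (-t) ^ k ≤ (1 - Real.exp (-t))⁻¹ :=
    sum_le_hasSum _ (fun _ _ => by positivity) (hasSum_geometric_of_lt_one hq0.le hq1)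
  refine (mul_le_mul_of_nonneg_left hgeo hq0.le).trans ?_
  rw [← div_eq_mul_inv, div_le_div_iff₀ (by linarith) ht]
  have h1 := Real.add_one_le_exp t
  have h2 : Real.exp (-t) * Real.exp t = 1 := by rw [← Real.exp_add]; simp
  nlinarith

/-- Expand `logCoth u` as 2 Σ q^(2m+1)/(2m+1) with q = e^{-2u} and sum over k first. The geometric
sum for each m is at most 1/(2a(2m+1)), which leaves (1/a) Σ 1/(2m+1)². -/
theorem sum_logCoth_le {a : ℝ} (ha : 0 < a) (N : ℕ) :
    ∑ k ∈ Finset.range N, logCoth (a * ((k : ℝ) + 1)) ≤ Real.pi ^ 2 / (8 * a) := by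
  have hs : ∀ k ∈ Finset.range N, HasSum
      (fun m : ℕ => (2 : ℝ) * (1 / (2 * m + 1)) * Real.exp (-2 * (a * ((k : ℝ) + 1))) ^ (2 * m + 1))
      (logCoth (a * ((k : ℝ) + 1))) := by
    intro k _
    refine Real.hasSum_log_sub_log_of_abs_lt_one ?_
    rw [abs_of_pos (Real.exp_pos _)]
    refine Real.exp_lt_one_iff.2 ?_
    have : 0 < a * ((k : ℝ) + 1) := by positivity
    linarith
  have h := hasSum_le (fun m => ?_) (hasSum_sum hs) (hasSum_one_div_odd_sq.mul_left (1 / a))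
  · refine h.trans_eq ?_
    field_simp
  · rw [← Finset.mul_sum]
    have hm : (0 : ℝ) < 2 * m + 1 := by positivity
    have h1 := sum_exp_neg_mul_le (t := 2 * a * (2 * m + 1)) (by positivity) N
    have h2 : ∀ k : ℕ, Real.exp (-2 * (a * ((k : ℝ) + 1))) ^ (2 * m + 1)
        = Real.exp (-(2 * a * (2 * m + 1) * ((k : ℝ) + 1))) := by
      intro k
      rw [← Real.exp_nat_mul]; push_cast; ring_nf
    simp only [h2]
    refine (mul_le_mul_of_nonneg_left h1 (by positivity)).trans_eq ?_
    field_simp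

/-- A sum of an antitone nonnegative function over `h`-separated points above `r` is dominated by
a sum over an arithmetic progression. -/
theorem exists_sum_le_sum_progression {ι : Type*} (s : Finset ι) (y : ι → ℝ) {r h : ℝ} (hr : 0 < r)
    (hh : 0 < h) (hy : ∀ i ∈ s, r ≤ y i)
    (hsep : ∀ i ∈ s, ∀ j ∈ s, i ≠ j → h ≤ |y i - y j|) {G : ℝ → ℝ} (hG : AntitoneOn G (Set.Ioi 0))
    (hG0 : ∀ u, 0 < u → 0 ≤ G u) :
    ∃ N : ℕ, ∑ i ∈ s, G (y i) ≤ ∑ k ∈ Finset.range N, G (r + h * k) := by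
  -- The half-open cells [r + hk, r + h(k+1)) hold at most one point each; moving a point to the
  -- left end of its cell can only increase `G`.
  set κ : ι → ℕ := fun i => ⌊(y i - r) / h⌋₊ with hκ
  have hlow : ∀ i ∈ s, h * κ i ≤ y i - r := fun i hi => by
    have := Nat.floor_le (div_nonneg (sub_nonneg.2 (hy i hi)) hh.le)
    rw [le_div_iff₀ hh] at this
    rw [mul_comm]; exact this
  have hup : ∀ i, y i - r < h * (κ i + 1) := fun i => by
    have := Nat.lt_floor_add_one ((y i - r) / h)
    rw [div_lt_iff₀ hh] at this
    rw [mul_comm]; exact this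
  have hinj : Set.InjOn κ s := by
    intro i hi j hj hij
    by_contra hne
    have h1 := hsep i hi j hj hne
    have h2 := hlow i hi
    have h3 := hlow j hj
    have h4 := hup i
    have h5 := hup j
    rw [hij] at h2 h4
    rcases le_abs.1 h1 with h6 | h6 <;> linarith
  obtain ⟨N, hN⟩ := Finset.exists_nat_subset_range (s.image κ)
  refine ⟨N, ?_⟩
  calc ∑ i ∈ s, G (y i) ≤ ∑ i ∈ s, G (r + h * κ i) := by
        refine Finset.sum_le_sum fun i hi => hG ?_ ?_ (by linarith [hlow i hi])
        · exact Set.mem_Ioi.2 (by positivity)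
        · exact Set.mem_Ioi.2 (hr.trans_le (hy i hi))
    _ = ∑ k ∈ s.image κ, G (r + h * k) := (Finset.sum_image (f := fun k : ℕ => G (r + h * k)) hinj).symm
    _ ≤ _ := Finset.sum_le_sum_of_subset_of_nonneg hN fun k _ _ => hG0 _ (by positivity)

theorem sum_logCoth_separated_le {ι : Type*} (s : Finset ι) (y : ι → ℝ) {r h : ℝ} (hr : 0 < r)
    (hh : 0 < h) (hy : ∀ i ∈ s, r ≤ y i)
    (hsep : ∀ i ∈ s, ∀ j ∈ s, i ≠ j → h ≤ |y i - y j|) :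
    ∑ i ∈ s, logCoth (y i) ≤ logCoth r + Real.pi ^ 2 / (8 * h) := by
  obtain ⟨N, hN⟩ := exists_sum_le_sum_progression s y hr hh hy hsep logCoth_antitoneOn
    fun u => logCoth_nonneg
  refine hN.trans ?_
  -- One extra term lets k = 0 be split off even if `N` is 0. That term is `logCoth r`; in the
  -- others `r` is dropped.
  have h1 : ∑ k ∈ Finset.range N, logCoth (r + h * k)
      ≤ ∑ k ∈ Finset.range (N + 1), logCoth (r + h * k) :=
    Finset.sum_le_sum_of_subset_of_nonneg (Finset.range_mono (Nat.le_succ N))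
      fun k _ _ => logCoth_nonneg (by positivity)
  refine h1.trans ?_
  rw [Finset.sum_range_succ', add_comm]
  refine add_le_add (by simp) ((Finset.sum_le_sum fun k _ => ?_).trans (sum_logCoth_le hh N))
  push_cast
  exact logCoth_antitoneOn (Set.mem_Ioi.2 (by positivity)) (Set.mem_Ioi.2 (by positivity))
    (by linarith)

/-! ## Blaschke factors of the strip -/

/-- The Blaschke factor `tanh (π (z - a) / (4d))` of the strip of half-width `d`. -/
noncomputable def stripBlaschke (d a : ℝ) (z : ℂ) : ℂ :=
  (Complex.exp ((Real.pi / (2 * d) : ℝ) * (z - a)) - 1) /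
    (Complex.exp ((Real.pi / (2 * d) : ℝ) * (z - a)) + 1)

/-- The restriction of `stripBlaschke` to the real line. -/
noncomputable def realBlaschke (d a x : ℝ) : ℝ :=
  (Real.exp (Real.pi / (2 * d) * (x - a)) - 1) / (Real.exp (Real.pi / (2 * d) * (x - a)) + 1)

theorem stripBlaschke_ofReal (d a x : ℝ) : stripBlaschke d a x = realBlaschke d a x := by
  simp only [stripBlaschke, realBlaschke]
  push_cast
  rfl

theorem realBlaschke_self (d a : ℝ) : realBlaschke d a a = 0 := by simp [realBlaschke]

theorem continuous_realBlaschke (d a : ℝ) : Continuous (realBlaschke d a) := by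
  unfold realBlaschke
  exact Continuous.div (by fun_prop) (by fun_prop) fun x => by positivity

/-- The exponential opens the strip into the right half-plane, which the Cayley map w ↦ (w - 1)/(w +
1) then sends into the unit disc. -/
theorem re_exp_pos_of_mem_strip {d a : ℝ} (hd : 0 < d) {z : ℂ} (hz : z ∈ strip d) :
    0 < (Complex.exp ((Real.pi / (2 * d) : ℝ) * (z - a))).re := by
  have hz : |z.im| < d := hz
  rw [Complex.exp_re]
  refine mul_pos (Real.exp_pos _) (Real.cos_pos_of_mem_Ioo ?_)
  rw [Complex.im_ofReal_mul, Complex.sub_im, Complex.ofReal_im,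
    sub_zero]
  rw [Set.mem_Ioo, ← abs_lt, abs_mul, abs_of_pos (by positivity)]
  calc Real.pi / (2 * d) * |z.im| < Real.pi / (2 * d) * d := by gcongr
    _ = Real.pi / 2 := by field_simp

theorem norm_sub_one_le_norm_add_one {w : ℂ} (hw : 0 < w.re) : ‖w - 1‖ ≤ ‖w + 1‖ := by
  refine (sq_le_sq₀ (norm_nonneg _) (norm_nonneg _)).1 ?_
  rw [Complex.sq_norm, Complex.sq_norm, Complex.normSq_apply, Complex.normSq_apply]
  simp only [Complex.sub_re, Complex.sub_im, Complex.add_re, Complex.add_im, Complex.one_re,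
    Complex.one_im]
  nlinarith

theorem norm_stripBlaschke_le_one {d : ℝ} (hd : 0 < d) (a : ℝ) {z : ℂ} (hz : z ∈ strip d) :
    ‖stripBlaschke d a z‖ ≤ 1 := by
  rw [stripBlaschke, norm_div]
  exact div_le_one_of_le₀ (norm_sub_one_le_norm_add_one (re_exp_pos_of_mem_strip hd hz))
    (norm_nonneg _)

theorem analyticOnNhd_stripBlaschke {d : ℝ} (hd : 0 < d) (a : ℝ) :
    AnalyticOnNhd ℂ (stripBlaschke d a) (strip d) := by
  intro z hz
  unfold stripBlaschke
  refine AnalyticAt.div (by fun_prop) (by fun_prop) fun h => ?_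
  have h1 := re_exp_pos_of_mem_strip (a := a) hd hz
  have h2 := congrArg Complex.re h
  simp only [Complex.add_re, Complex.one_re, Complex.zero_re] at h2
  linarith

theorem realBlaschke_sq {d a x : ℝ} (hd : 0 < d) (hx : x ≠ a) :
    realBlaschke d a x ^ 2 = Real.exp (-2 * logCoth (Real.pi / (4 * d) * |x - a|)) := by
  have hc : 0 < Real.pi / (4 * d) := by positivity
  have h2 : Real.exp (-2 * logCoth (Real.pi / (4 * d) * |x - a|))
      = Real.exp (-logCoth (Real.pi / (4 * d) * |x - a|)) ^ 2 := by
    rw [← Real.exp_nat_mul]; push_cast; ring_nf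
  rw [h2, exp_neg_logCoth (mul_pos hc (abs_pos.2 (sub_ne_zero.2 hx))), realBlaschke]
  rcases lt_or_gt_of_ne hx with h | h
  · have he : -2 * (Real.pi / (4 * d) * |x - a|) = Real.pi / (2 * d) * (x - a) := by
      rw [abs_of_neg (sub_neg.2 h)]; field_simp; ring
    rw [he]
    have := Real.exp_pos (Real.pi / (2 * d) * (x - a))
    field_simp
    ring
  · have he : -2 * (Real.pi / (4 * d) * |x - a|) = -(Real.pi / (2 * d) * (x - a)) := by
      rw [abs_of_pos (sub_pos.2 h)]; field_simp; ring
    rw [he, Real.exp_neg]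
    have := Real.exp_pos (Real.pi / (2 * d) * (x - a))
    field_simp

/-! ## The squared Blaschke product at the Hermite nodes -/

/-- The squared Blaschke product of the strip at the Hermite nodes. -/
noncomputable def nodeBlaschke (d : ℝ) (n : ℕ) (z : ℂ) : ℂ :=
  ∏ i, stripBlaschke d (hermiteNode n i) z ^ 2

/-- The restriction of `nodeBlaschke` to the real line. -/
noncomputable def realNodeBlaschke (d : ℝ) (n : ℕ) (x : ℝ) : ℝ :=
  ∏ i, realBlaschke d (hermiteNode n i) x ^ 2

theorem nodeBlaschke_ofReal (d : ℝ) (n : ℕ) (x : ℝ) :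
    nodeBlaschke d n x = realNodeBlaschke d n x := by
  simp [nodeBlaschke, realNodeBlaschke, stripBlaschke_ofReal]

theorem nodeBlaschke_node (d : ℝ) (n : ℕ) (i : Fin n) :
    nodeBlaschke d n (hermiteNode n i) = 0 :=
  Finset.prod_eq_zero (Finset.mem_univ i) (by rw [stripBlaschke_ofReal, realBlaschke_self]; simp)

theorem norm_nodeBlaschke_le_one {d : ℝ} (hd : 0 < d) (n : ℕ) {z : ℂ} (hz : z ∈ strip d) :
    ‖nodeBlaschke d n z‖ ≤ 1 := by
  rw [nodeBlaschke, norm_prod]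
  refine Finset.prod_le_one (fun _ _ => norm_nonneg _) fun i _ => ?_
  rw [norm_pow]
  exact pow_le_one₀ (norm_nonneg _) (norm_stripBlaschke_le_one hd _ hz)

theorem analyticOnNhd_nodeBlaschke {d : ℝ} (hd : 0 < d) (n : ℕ) :
    AnalyticOnNhd ℂ (nodeBlaschke d n) (strip d) :=
  Finset.analyticOnNhd_fun_prod _ fun _ _ => (analyticOnNhd_stripBlaschke hd _).pow 2

theorem realNodeBlaschke_nonneg (d : ℝ) (n : ℕ) (x : ℝ) : 0 ≤ realNodeBlaschke d n x :=
  Finset.prod_nonneg fun _ _ => sq_nonneg _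

theorem continuous_realNodeBlaschke (d : ℝ) (n : ℕ) : Continuous (realNodeBlaschke d n) :=
  continuous_finsetProd _ fun i _ => (continuous_realBlaschke d (hermiteNode n i)).pow 2

theorem ofReal_mem_strip {d : ℝ} (hd : 0 < d) (x : ℝ) : (x : ℂ) ∈ strip d := by
  simpa [strip] using hd

theorem realNodeBlaschke_le_one {d : ℝ} (hd : 0 < d) (n : ℕ) (x : ℝ) :
    realNodeBlaschke d n x ≤ 1 := by
  have h := norm_nodeBlaschke_le_one hd n (ofReal_mem_strip hd x)
  rw [nodeBlaschke_ofReal, Complex.norm_real] at h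
  exact (le_abs_self _).trans h

/-- Lower bound on the squared Blaschke product away from the nodes. -/
theorem realNodeBlaschke_ge {d : ℝ} (hd : 0 < d) (n : ℕ) {δ x : ℝ} (hδ : 0 < δ)
    (hx : ∀ i, δ ≤ |x - hermiteNode n i|) :
    Real.exp (-logCoth (Real.pi / (4 * d) * δ)) ^ 4 * Real.exp (-2 * d * √(2 * n + 1))
      ≤ realNodeBlaschke d n x := by
  set c := Real.pi / (4 * d) with hc
  have hc0 : 0 < c := by positivity
  have hl : 0 < √(2 * n + 1 : ℝ) := by positivity
  have hne : ∀ i, x ≠ hermiteNode n i := fun i h => by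
    have := hx i
    rw [h, sub_self, abs_zero] at this
    linarith
  -- For nodes on one side of `x`, differences of distances to `x` are differences of nodes, so the
  -- gap bound applies. With c = π/(4d) and spacing cπ/√(2n+1), the progression costs d√(2n+1)/2.
  have hside : ∀ s : Finset (Fin n), (∀ i ∈ s, ∀ j ∈ s,
      |(|x - hermiteNode n i| - |x - hermiteNode n j|)| = |hermiteNode n i - hermiteNode n j|) →
      ∑ i ∈ s, logCoth (c * |x - hermiteNode n i|) ≤ logCoth (c * δ) + d * √(2 * n + 1) / 2 := by
    intro s hs
    refine (sum_logCoth_separated_le s (fun i => c * |x - hermiteNode n i|) (r := c * δ)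
      (h := c * (Real.pi / √(2 * n + 1))) (by positivity) (by positivity)
      (fun i _ => mul_le_mul_of_nonneg_left (hx i) hc0.le) fun i hi j hj hij => ?_).trans_eq ?_
    · rw [← mul_sub, abs_mul, abs_of_pos hc0, hs i hi j hj]
      exact mul_le_mul_of_nonneg_left (hermiteNode_gap hij) hc0.le
    · rw [hc]
      field_simp
      ring
  have h1 := hside (Finset.univ.filter fun i => hermiteNode n i < x) fun i hi j hj => by
    simp only [Finset.mem_filter, Finset.mem_univ, true_and] at hi hj
    rw [abs_of_pos (sub_pos.2 hi), abs_of_pos (sub_pos.2 hj), abs_sub_comm]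
    ring_nf
  have h2 := hside (Finset.univ.filter fun i => ¬ hermiteNode n i < x) fun i hi j hj => by
    simp only [Finset.mem_filter, Finset.mem_univ, true_and, not_lt] at hi hj
    rw [abs_of_nonpos (sub_nonpos.2 hi), abs_of_nonpos (sub_nonpos.2 hj)]
    ring_nf
  have h3 := Finset.sum_filter_add_sum_filter_not Finset.univ (fun i => hermiteNode n i < x)
    fun i => logCoth (c * |x - hermiteNode n i|)
  have h4 : realNodeBlaschke d n x
      = Real.exp (-2 * ∑ i, logCoth (c * |x - hermiteNode n i|)) := by
    rw [Finset.mul_sum, Real.exp_sum]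
    exact Finset.prod_congr rfl fun i _ => realBlaschke_sq hd (hne i)
  rw [h4, ← Real.exp_nat_mul, ← Real.exp_add, Real.exp_le_exp]
  push_cast
  linarith

/-- The right side is tanh u = (1 - q)/(1 + q) with q = e^{-2u}; use q ≤ 1/(1 + 2u) above and q ≤ 1
below. Being linear near 0, the bound turns closeness to a node into a power of n. -/
theorem div_le_exp_neg_logCoth {u : ℝ} (hu : 0 < u) :
    u / (1 + 2 * u) ≤ Real.exp (-logCoth u) := by
  rw [exp_neg_logCoth hu, div_le_div_iff₀ (by positivity) (by positivity)]
  have h1 := Real.add_one_le_exp (2 * u)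
  have h2 : Real.exp (-2 * u) * Real.exp (2 * u) = 1 := by rw [← Real.exp_add]; simp
  have h3 : Real.exp (-2 * u) * (1 + 2 * u) ≤ 1 := by
    nlinarith [Real.exp_pos (-2 * u)]
  have h4 : Real.exp (-2 * u) ≤ 1 := Real.exp_le_one_iff.2 (by linarith)
  nlinarith

theorem hermiteGap_le {n : ℕ} (hn : 2 ≤ n) : Real.pi / √(2 * n + 1) ≤ 2 := by
  have h2 : (2 : ℝ) ≤ n := by exact_mod_cast hn
  have hl : (2 : ℝ) ≤ √(2 * n + 1) := Real.le_sqrt_of_sq_le (by linarith)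
  rw [div_le_iff₀ (by linarith)]
  linarith [Real.pi_le_four]

/-- At least one of two points half a gap apart stays away from all Hermite nodes. -/
theorem dist_hermiteNode_or (n : ℕ) (x : ℝ) :
    (∀ i, Real.pi / √(2 * n + 1) / 4 ≤ |x - hermiteNode n i|) ∨
      ∀ i, Real.pi / √(2 * n + 1) / 4 ≤ |x + Real.pi / √(2 * n + 1) / 2 - hermiteNode n i| := by
  have hh : 0 < Real.pi / √(2 * n + 1) := by positivity
  by_contra! hcon
  obtain ⟨⟨i, hi⟩, j, hj⟩ := hcon
  have hgap : i ≠ j → _ := hermiteNode_gap (n := n) (i := i) (j := j)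
  rw [abs_lt] at hi hj
  -- One common node would put `x` and `x + h/2` less than h/2 apart; two distinct nodes would be
  -- closer than h/4 + h/2 + h/4 = h.
  by_cases hij : i = j
  · subst hij
    linarith [hi.1, hj.2]
  · rcases le_abs.1 (hgap hij) with h | h <;> linarith [hi.1, hj.2, hi.2, hj.1]

/-- The factor by which the squared Blaschke product is bounded below, up to the exponential. -/
noncomputable def blaschkeConst (d : ℝ) : ℝ :=
  (Real.pi / (16 * d) / (1 + Real.pi / (4 * d))) ^ 4 * (Real.pi ^ 4 / 4)

theorem blaschkeConst_pos {d : ℝ} (hd : 0 < d) : 0 < blaschkeConst d := by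
  unfold blaschkeConst; positivity

theorem blaschkeConst_mul_le {d : ℝ} (hd : 0 < d) {n : ℕ} (hn : 2 ≤ n) {x : ℝ}
    (hx : ∀ i, Real.pi / √(2 * n + 1) / 4 ≤ |x - hermiteNode n i|) :
    blaschkeConst d * (Real.exp (-2 * d * √(2 * n + 1)) / ((n : ℝ) + 1 / 2) ^ 2)
      ≤ realNodeBlaschke d n x := by
  have hl : 0 < √(2 * n + 1 : ℝ) := by positivity
  have hl2 : √(2 * n + 1 : ℝ) ^ 2 = 2 * n + 1 := Real.sq_sqrt (by positivity)
  have hgap := hermiteGap_le hn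
  refine le_trans ?_ (realNodeBlaschke_ge hd n (by positivity) hx)
  set l := √(2 * n + 1 : ℝ)
  -- Here u = (π/(16d))h, and h ≤ 2 gives 1 + 2u ≤ 1 + π/(4d). The fourth power then produces h⁴ =
  -- π⁴/l⁴ with l⁴ = 4(n + 1/2)².
  have hκ : Real.pi / (16 * d) / (1 + Real.pi / (4 * d)) * (Real.pi / l)
      ≤ Real.exp (-logCoth (Real.pi / (4 * d) * (Real.pi / l / 4))) := by
    refine le_trans ?_ (div_le_exp_neg_logCoth (by positivity))
    rw [div_mul_eq_mul_div, show Real.pi / (4 * d) * (Real.pi / l / 4)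
      = Real.pi / (16 * d) * (Real.pi / l) by field_simp; ring]
    refine div_le_div_of_nonneg_left (by positivity) (by positivity) ?_
    have : Real.pi / (16 * d) * (Real.pi / l) ≤ Real.pi / (16 * d) * 2 :=
      mul_le_mul_of_nonneg_left hgap (by positivity)
    have h4 : Real.pi / (4 * d) = 2 * (Real.pi / (16 * d) * 2) := by field_simp; ring
    linarith
  have hn4 : ((n : ℝ) + 1 / 2) ^ 2 = l ^ 4 / 4 := by
    rw [show l ^ 4 = (l ^ 2) ^ 2 by ring, hl2]; ring
  refine le_trans (le_of_eq ?_) (mul_le_mul_of_nonneg_right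
    (pow_le_pow_left₀ (by positivity) hκ 4) (Real.exp_pos _).le)
  rw [blaschkeConst, hn4, mul_pow, div_pow Real.pi l]
  field_simp

theorem blaschkeConst_mul_le_integral {d : ℝ} (hd : 0 < d) {n : ℕ} (hn : 2 ≤ n) :
    blaschkeConst d / 2 * (Real.exp (-2 * d * √(2 * n + 1)) / ((n : ℝ) + 1 / 2) ^ 2)
      ≤ ∫ x in (0 : ℝ)..2, realNodeBlaschke d n x := by
  have hgap := hermiteGap_le hn
  have hh : 0 < Real.pi / √(2 * n + 1 : ℝ) := by positivity
  set h := Real.pi / √(2 * n + 1 : ℝ)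
  set b := realNodeBlaschke d n with hb
  have hcont : Continuous b := continuous_realNodeBlaschke d n
  have hb0 : ∀ x, 0 ≤ b x := realNodeBlaschke_nonneg d n
  set m := blaschkeConst d * (Real.exp (-2 * d * √(2 * n + 1)) / ((n : ℝ) + 1 / 2) ^ 2) with hm
  have hpt : ∀ x, m ≤ b x + b (x + h / 2) := fun x => by
    rcases dist_hermiteNode_or n x with hx | hx
    · linarith [blaschkeConst_mul_le hd hn hx, hb0 (x + h / 2)]
    · linarith [blaschkeConst_mul_le hd hn hx, hb0 x]
  have hint : ∀ u v : ℝ, IntervalIntegrable b volume u v := fun u v => hcont.intervalIntegrable u v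
  have hcont' : Continuous fun x => b (x + h / 2) := by fun_prop
  have h1 : m ≤ ∫ x in (0 : ℝ)..1, (b x + b (x + h / 2)) := by
    have := intervalIntegral.integral_mono_on (a := 0) (b := 1) (μ := volume) zero_le_one
      (intervalIntegrable_const (c := m)) ((hcont.add hcont').intervalIntegrable 0 1)
      fun x _ => hpt x
    simpa using this
  rw [intervalIntegral.integral_add (hint 0 1) (hcont'.intervalIntegrable 0 1),
    intervalIntegral.integral_comp_add_right] at h1
  have hmono : ∀ u v : ℝ, 0 ≤ u → u ≤ v → v ≤ 2 → ∫ x in u..v, b x ≤ ∫ x in (0 : ℝ)..2, b x :=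
    fun u v h0 huv h2 => intervalIntegral.integral_mono_interval h0 huv h2
      (Eventually.of_forall hb0) (hint 0 2)
  have h2 := hmono 0 1 le_rfl zero_le_one one_le_two
  -- Since h ≤ 2, the shifted unit interval stays in [0,2]. Both integrals are bounded by the one
  -- over [0,2], hence the factor 1/2.
  have h3 := hmono (0 + h / 2) (1 + h / 2) (by linarith) (by linarith) (by linarith)
  rw [div_mul_eq_mul_div]
  linarith

/-! ## Worst-case error -/

theorem IsWeight.eq_ofReal {d : ℝ} {ω : ℂ → ℂ} (hω : IsWeight d ω) (x : ℝ) :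
    ω x = ((ω x).re : ℂ) :=
  Complex.ext rfl (by simpa using hω.real x)

theorem IsWeight.norm_ofReal {d : ℝ} {ω : ℂ → ℂ} (hω : IsWeight d ω) (x : ℝ) :
    ‖ω x‖ = (ω x).re := by
  rw [hω.eq_ofReal x, Complex.norm_real, Complex.ofReal_re, Real.norm_of_nonneg (hω.pos x).le]

theorem IsWeight.continuous_re {d : ℝ} (hd : 0 < d) {ω : ℂ → ℂ} (hω : IsWeight d ω) :
    Continuous fun x : ℝ => (ω x).re :=
  Complex.continuous_re.comp <| continuous_iff_continuousAt.2 fun x =>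
    ((hω.analytic x (ofReal_mem_strip hd x)).continuousAt).comp
      Complex.continuous_ofReal.continuousAt

theorem norm_le_of_hardyNorm_le_one {d : ℝ} {ω f : ℂ → ℂ} (hω : IsWeight d ω)
    (hf : f ∈ hardySpace d ω) (hn : hardyNorm d ω f ≤ 1) {z : ℂ} (hz : z ∈ strip d) :
    ‖f z‖ ≤ ‖ω z‖ := by
  have h := (le_csSup hf.2 ⟨z, hz, rfl⟩).trans hn
  dsimp only at h
  rwa [norm_div, div_le_one (norm_pos_iff.2 (hω.ne_zero z hz))] at h

/-- A real `sSup` is 0 on unbounded sets, so a single function bounds the worst-case error from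
below only once the errors are known to be bounded. This follows from |f| ≤ ω on the real line and
integrability of `ω`. -/
theorem bddAbove_errors {d : ℝ} (hd : 0 < d) {ω : ℂ → ℂ} (hω : IsWeight d ω)
    (hint : Integrable fun x : ℝ => (ω x).re) {n : ℕ} (ξ w : Fin n → ℝ) :
    BddAbove ((fun f => ‖quadrature ξ w f - ∫ x : ℝ, f x‖) ''
      {f | f ∈ hardySpace d ω ∧ hardyNorm d ω f ≤ 1}) := by
  refine ⟨∑ i, |w i| * (ω (ξ i)).re + ∫ x : ℝ, (ω x).re, ?_⟩
  rintro _ ⟨f, ⟨hf, hn⟩, rfl⟩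
  have hb : ∀ x : ℝ, ‖f x‖ ≤ (ω x).re := fun x =>
    (norm_le_of_hardyNorm_le_one hω hf hn (ofReal_mem_strip hd x)).trans_eq (hω.norm_ofReal x)
  refine (norm_sub_le _ _).trans (add_le_add ?_
    (norm_integral_le_of_norm_le hint (Eventually.of_forall hb)))
  refine norm_sum_le_of_le _ fun i _ => ?_
  rw [norm_mul, Complex.norm_real, Real.norm_eq_abs]
  exact mul_le_mul_of_nonneg_left (hb _) (abs_nonneg _)

theorem mul_nodeBlaschke_mem_unitBall {d : ℝ} (hd : 0 < d) {ω : ℂ → ℂ} (hω : IsWeight d ω)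
    (n : ℕ) : (fun z => ω z * nodeBlaschke d n z) ∈
      {f | f ∈ hardySpace d ω ∧ hardyNorm d ω f ≤ 1} := by
  have hb : ∀ y ∈ (fun z => ‖ω z * nodeBlaschke d n z / ω z‖) '' strip d, y ≤ 1 := by
    rintro _ ⟨z, hz, rfl⟩
    dsimp only
    rw [mul_div_cancel_left₀ _ (hω.ne_zero z hz)]
    exact norm_nodeBlaschke_le_one hd n hz
  exact ⟨⟨hω.analytic.mul (analyticOnNhd_nodeBlaschke hd n), 1, hb⟩,
    csSup_le (Set.Nonempty.image _ ⟨_, ofReal_mem_strip hd 0⟩) hb⟩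

theorem worstCaseError_ge {d : ℝ} (hd : 0 < d) {ω : ℂ → ℂ} (hω : IsWeight d ω)
    (hint : Integrable fun x : ℝ => (ω x).re) {n : ℕ} (hn : 2 ≤ n) :
    (ω 2).re * (blaschkeConst d / 2) *
        (Real.exp (-2 * d * √(2 * n + 1)) / ((n : ℝ) + 1 / 2) ^ 2)
      ≤ worstCaseError d ω (gaussHermite n) := by
  have hcω := hω.continuous_re hd
  have hcb := continuous_realNodeBlaschke d n
  have hnn : ∀ x : ℝ, 0 ≤ (ω x).re * realNodeBlaschke d n x := fun x =>
    mul_nonneg (hω.pos x).le (realNodeBlaschke_nonneg d n x)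
  have hfint : Integrable fun x : ℝ => (ω x).re * realNodeBlaschke d n x := by
    refine hint.mono' (hcω.mul hcb).aestronglyMeasurable (Eventually.of_forall fun x => ?_)
    rw [Real.norm_of_nonneg (hnn x)]
    exact mul_le_of_le_one_right (hω.pos x).le (realNodeBlaschke_le_one hd n x)
  refine le_trans ?_ (le_csSup (bddAbove_errors hd hω hint _ _)
    ⟨_, mul_nodeBlaschke_mem_unitBall hd hω n, rfl⟩)
  have hq : gaussHermite n (fun z => ω z * nodeBlaschke d n z) = 0 := by
    simp [gaussHermite, quadrature, nodeBlaschke_node]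
  have hI : ∫ x : ℝ, (ω x * nodeBlaschke d n x)
      = ((∫ x : ℝ, (ω x).re * realNodeBlaschke d n x : ℝ) : ℂ) := by
    rw [← integral_complex_ofReal]
    refine integral_congr_ae (Eventually.of_forall fun x => ?_)
    simp only [Complex.ofReal_mul]
    rw [nodeBlaschke_ofReal, ← hω.eq_ofReal]
  dsimp only
  rw [hq, hI, zero_sub, norm_neg, Complex.norm_real]
  refine le_trans ?_ (le_abs_self _)
  have h1 : ∫ x in (0 : ℝ)..2, (ω x).re * realNodeBlaschke d n x
      ≤ ∫ x : ℝ, (ω x).re * realNodeBlaschke d n x := by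
    rw [intervalIntegral.integral_of_le zero_le_two]
    exact setIntegral_le_integral hfint (Eventually.of_forall hnn)
  refine le_trans ?_ h1
  -- On [0,2] the weight is smallest at 2, so only its value there enters the bound.
  have h2 : ∫ x in (0 : ℝ)..2, (ω 2).re * realNodeBlaschke d n x
      ≤ ∫ x in (0 : ℝ)..2, (ω x).re * realNodeBlaschke d n x := by
    refine intervalIntegral.integral_mono_on zero_le_two
      ((hcb.const_mul _).intervalIntegrable _ _) ((hcω.mul hcb).intervalIntegrable _ _)
      fun x hx => mul_le_mul_of_nonneg_right ?_ (realNodeBlaschke_nonneg d n x)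
    have := hω.antitone (Set.mem_Ici.2 hx.1) (Set.mem_Ici.2 zero_le_two) hx.2
    simpa using this
  refine le_trans ?_ h2
  rw [intervalIntegral.integral_const_mul, mul_assoc]
  refine mul_le_mul_of_nonneg_left (blaschkeConst_mul_le_integral hd hn) ?_
  simpa using (hω.pos 2).le

/-! ## Weights of single- and double-exponential decay -/

theorem integrable_exp_neg_mul_abs {b : ℝ} (hb : 0 < b) :
    Integrable fun x : ℝ => Real.exp (-b * |x|) := by
  rw [← integrableOn_univ, ← Set.Iic_union_Ioi (a := (0 : ℝ)), integrableOn_union]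
  constructor
  · refine (integrableOn_exp_mul_Iic hb 0).congr_fun (fun x hx => ?_) measurableSet_Iic
    dsimp only
    rw [abs_of_nonpos hx]; ring_nf
  · refine (integrableOn_exp_mul_Ioi (neg_lt_zero.2 hb) 0).congr_fun (fun x hx => ?_)
      measurableSet_Ioi
    dsimp only
    rw [abs_of_pos hx]

theorem IsWeight.integrable_of_le {d : ℝ} (hd : 0 < d) {ω : ℂ → ℂ} (hω : IsWeight d ω) {A b : ℝ}
    (hb : 0 < b) (h : ∀ x : ℝ, (ω x).re ≤ A * Real.exp (-b * |x|)) :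
    Integrable fun x : ℝ => (ω x).re := by
  refine ((integrable_exp_neg_mul_abs hb).const_mul A).mono'
    (hω.continuous_re hd).aestronglyMeasurable (Eventually.of_forall fun x => ?_)
  rw [Real.norm_of_nonneg (hω.pos x).le]
  exact h x

theorem IsSE.integrable {d α₁ α₂ β ρ : ℝ} (hd : 0 < d) {ω : ℂ → ℂ} (hω : IsWeight d ω)
    (h : IsSE α₁ α₂ β ρ ω) : Integrable fun x : ℝ => (ω x).re := by
  -- With t = β|x|, t^ρ ≥ t - 1 always: t^ρ ≥ t for t ≥ 1, and the right side is nonpositive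
  -- otherwise. The factor e absorbs the 1.
  refine hω.integrable_of_le hd (A := α₂ * Real.exp 1) h.β_pos fun x => (h.upper x).trans ?_
  rw [mul_assoc, ← Real.exp_add]
  refine mul_le_mul_of_nonneg_left (Real.exp_le_exp.2 ?_) h.α₂_pos.le
  have ht : 0 ≤ β * |x| := mul_nonneg h.β_pos.le (abs_nonneg x)
  rcases le_total 1 (β * |x|) with h1 | h1
  · have := Real.self_le_rpow_of_one_le h1 h.one_le_ρ
    linarith
  · have := Real.rpow_nonneg ht ρ
    linarith

theorem IsDE.integrable {d α₁ α₂ β₁ β₂ γ : ℝ} (hd : 0 < d) {ω : ℂ → ℂ} (hω : IsWeight d ω)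
    (h : IsDE α₁ α₂ β₁ β₂ γ ω) : Integrable fun x : ℝ => (ω x).re := by
  refine hω.integrable_of_le hd (A := α₂) (mul_pos h.β₂_pos h.γ_pos)
    fun x => (h.upper x).trans ?_
  refine mul_le_mul_of_nonneg_left (Real.exp_le_exp.2 ?_) h.α₂_pos.le
  have h1 := Real.add_one_le_exp (γ * |x|)
  nlinarith [h.β₂_pos]

/-- Fixing `c` before `ω` records the uniformity: beyond `d`, it depends only on a lower bound for
ω(2), which the decay hypotheses supply. -/
theorem exists_lower_constant {d A : ℝ} (hd : 0 < d) (hA : 0 < A) :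
    ∃ c : ℝ, 0 < c ∧ ∀ ω : ℂ → ℂ, IsWeight d ω → (Integrable fun x : ℝ => (ω x).re) →
      A ≤ (ω 2).re → ∀ n : ℕ, 2 ≤ n →
        c * (Real.exp (-2 * d * √(2 * n + 1)) / ((n : ℝ) + 1 / 2) ^ 2) ≤
          worstCaseError d ω (gaussHermite n) := by
  have hB := blaschkeConst_pos hd
  refine ⟨A * (blaschkeConst d / 2), by positivity, fun ω hω hint hA2 n hn => ?_⟩
  refine le_trans ?_ (worstCaseError_ge hd hω hint hn)
  gcongr

theorem exists_lower_constant_SE {d : ℝ} (hd : 0 < d) (α₁ β ρ : ℝ) : ∃ c : ℝ, 0 < c ∧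
    ∀ (α₂ : ℝ) (ω : ℂ → ℂ), IsWeight d ω → IsSE α₁ α₂ β ρ ω → ∀ n : ℕ, 2 ≤ n →
      c * (Real.exp (-2 * d * √(2 * n + 1)) / ((n : ℝ) + 1 / 2) ^ 2) ≤
        worstCaseError d ω (gaussHermite n) := by
  rcases le_or_gt α₁ 0 with hα | hα
  -- No weight has α₁ ≤ 0, so any positive constant serves.
  · exact ⟨1, one_pos, fun α₂ ω _ h => absurd h.α₁_pos hα.not_gt⟩
  obtain ⟨c, hc, H⟩ := exists_lower_constant hd (A := α₁ * Real.exp (-(β * |2|) ^ ρ))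
    (by positivity)
  exact ⟨c, hc, fun α₂ ω hω h => H ω hω (h.integrable hd hω) (by simpa using h.lower 2)⟩

theorem exists_lower_constant_DE {d : ℝ} (hd : 0 < d) (α₁ β₁ γ : ℝ) : ∃ c : ℝ, 0 < c ∧
    ∀ (α₂ β₂ : ℝ) (ω : ℂ → ℂ), IsWeight d ω → IsDE α₁ α₂ β₁ β₂ γ ω → ∀ n : ℕ, 2 ≤ n →
      c * (Real.exp (-2 * d * √(2 * n + 1)) / ((n : ℝ) + 1 / 2) ^ 2) ≤
        worstCaseError d ω (gaussHermite n) := by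
  rcases le_or_gt α₁ 0 with hα | hα
  · exact ⟨1, one_pos, fun α₂ β₂ ω _ h => absurd h.α₁_pos hα.not_gt⟩
  obtain ⟨c, hc, H⟩ := exists_lower_constant hd (A := α₁ * Real.exp (-β₁ * Real.exp (γ * |2|)))
    (by positivity)
  exact ⟨c, hc, fun α₂ β₂ ω hω h => H ω hω (h.integrable hd hω) (by simpa using h.lower 2)⟩

/-! ### Comparison with exp(-C√n) -/

theorem exp_neg_mul_sqrt_isLittleO {d C : ℝ} (hd : 0 < d) (hC : 2 * √2 * d < C) :
    (fun n : ℕ => Real.exp (-C * √n)) =o[atTop]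
      fun n : ℕ => Real.exp (-2 * d * √(2 * n + 1)) / ((n : ℝ) + 1 / 2) ^ 2 := by
  have hε : 0 < C - 2 * √2 * d := sub_pos.2 hC
  set ε := C - 2 * √2 * d with hεdef
  -- This majorant of the quotient comes from √(2n+1) ≤ √2 √n + 1, which costs e^{2d}, and from
  -- bounding (n + 1/2)² by a polynomial in √n.
  have hlim : Tendsto (fun n : ℕ => Real.exp (2 * d) *
      ((√n ^ 4 + √n ^ 2 + 1) * Real.exp (-ε * √n))) atTop (𝓝 0) := by
    have hs : Tendsto (fun n : ℕ => √(n : ℝ)) atTop atTop :=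
      Real.tendsto_sqrt_atTop.comp tendsto_natCast_atTop_atTop
    have hk : ∀ k : ℕ, Tendsto (fun n : ℕ => √(n : ℝ) ^ k * Real.exp (-ε * √n)) atTop (𝓝 0) :=
      fun k => by
        have := (tendsto_rpow_mul_exp_neg_mul_atTop_nhds_zero k ε hε).comp hs
        simpa [Function.comp_def] using this
    have := (((hk 4).add (hk 2)).add (hk 0)).const_mul (Real.exp (2 * d))
    simp only [add_zero, mul_zero, pow_zero] at this
    refine this.congr fun n => by ring
  refine Asymptotics.isLittleO_of_tendsto' (Eventually.of_forall fun n h0 => ?_) ?_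
  · exact absurd h0 (by positivity)
  refine squeeze_zero (fun n => by positivity) (fun n => ?_) hlim
  have hn : √(n : ℝ) ^ 2 = n := Real.sq_sqrt n.cast_nonneg
  have h1 : √(2 * n + 1 : ℝ) ≤ √2 * √n + 1 := by
    refine Real.sqrt_le_iff.2 ⟨by positivity, ?_⟩
    have h2 : √(2 : ℝ) ^ 2 = 2 := Real.sq_sqrt zero_le_two
    have h3 : 0 ≤ √(2 : ℝ) * √n := by positivity
    nlinarith
  rw [div_div_eq_mul_div, div_le_iff₀ (Real.exp_pos _)]
  have h4 : ((n : ℝ) + 1 / 2) ^ 2 ≤ √n ^ 4 + √n ^ 2 + 1 := by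
    rw [show √(n : ℝ) ^ 4 = (√n ^ 2) ^ 2 by ring, hn]; nlinarith
  have h5 : Real.exp (-C * √n)
      ≤ Real.exp (2 * d) * Real.exp (-ε * √n) * Real.exp (-2 * d * √(2 * n + 1)) := by
    rw [← Real.exp_add, ← Real.exp_add, Real.exp_le_exp, hεdef]
    nlinarith
  calc Real.exp (-C * √n) * ((n : ℝ) + 1 / 2) ^ 2
      ≤ (Real.exp (2 * d) * Real.exp (-ε * √n) * Real.exp (-2 * d * √(2 * n + 1)))
        * (√n ^ 4 + √n ^ 2 + 1) := mul_le_mul h5 h4 (by positivity) (by positivity)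
    _ = _ := by ring

theorem isLittleO_of_lower_bound {d C c : ℝ} (hd : 0 < d) (hC : 2 * √2 * d < C) (hc : 0 < c)
    {e : ℕ → ℝ} (h : ∀ n : ℕ, 2 ≤ n →
      c * (Real.exp (-2 * d * √(2 * n + 1)) / ((n : ℝ) + 1 / 2) ^ 2) ≤ e n) :
    (fun n : ℕ => Real.exp (-C * √n)) =o[atTop] e := by
  refine (exp_neg_mul_sqrt_isLittleO hd hC).trans_isBigO (Asymptotics.IsBigO.of_bound c⁻¹ ?_)
  filter_upwards [eventually_ge_atTop 2] with n hn
  rw [Real.norm_of_nonneg (by positivity), inv_mul_eq_div, le_div_iff₀ hc, mul_comm]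
  exact (h n hn).trans (le_abs_self _)

end GaussHermite

theorem mainTheorem6 (d : ℝ) (hd : 0 < d) :
    (∀ α₁ β ρ : ℝ, ∃ c : ℝ, 0 < c ∧
      ∀ (α₂ : ℝ) (ω : ℂ → ℂ), GaussHermite.IsWeight d ω → GaussHermite.IsSE α₁ α₂ β ρ ω →
        ∀ n : ℕ, 2 ≤ n →
          c * (Real.exp (-2 * d * √(2 * n + 1)) / ((n : ℝ) + 1 / 2) ^ 2) ≤
            GaussHermite.worstCaseError d ω (GaussHermite.gaussHermite n)) ∧
    (∀ α₁ β₁ γ : ℝ, ∃ c : ℝ, 0 < c ∧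
      ∀ (α₂ β₂ : ℝ) (ω : ℂ → ℂ), GaussHermite.IsWeight d ω →
        GaussHermite.IsDE α₁ α₂ β₁ β₂ γ ω →
        ∀ n : ℕ, 2 ≤ n →
          c * (Real.exp (-2 * d * √(2 * n + 1)) / ((n : ℝ) + 1 / 2) ^ 2) ≤
            GaussHermite.worstCaseError d ω (GaussHermite.gaussHermite n)) ∧
    (∀ ω : ℂ → ℂ, GaussHermite.IsWeight d ω →
      ((∃ α₁ α₂ β ρ : ℝ, GaussHermite.IsSE α₁ α₂ β ρ ω) ∨
        (∃ α₁ α₂ β₁ β₂ γ : ℝ, GaussHermite.IsDE α₁ α₂ β₁ β₂ γ ω)) →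
      ∀ C : ℝ, 2 * √2 * d < C →
        (fun n : ℕ => Real.exp (-C * √n)) =o[Filter.atTop]
          (fun n : ℕ => GaussHermite.worstCaseError d ω (GaussHermite.gaussHermite n))) := by
  refine ⟨GaussHermite.exists_lower_constant_SE hd, GaussHermite.exists_lower_constant_DE hd, ?_⟩
  rintro ω hω (⟨α₁, α₂, β, ρ, h⟩ | ⟨α₁, α₂, β₁, β₂, γ, h⟩) C hC
  · obtain ⟨c, hc, H⟩ := GaussHermite.exists_lower_constant_SE hd α₁ β ρ
    exact GaussHermite.isLittleO_of_lower_bound hd hC hc (H α₂ ω hω h)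
  · obtain ⟨c, hc, H⟩ := GaussHermite.exists_lower_constant_DE hd α₁ β₁ γ
    exact GaussHermite.isLittleO_of_lower_bound hd hC hc (H α₂ β₂ ω hω h)
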